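/- Let $\ell^2(\mathbb{Z}_+)$ have standard basis $\{e_n\}_{n\ge 0}$, let $T e_n=e_{n+1}$ be the right shift, and let $\mathcal{T}\subset\mathcal{B}(\ell^2(\mathbb{Z}_+))$ be the Toeplitz algebra, i.e. the norm closed algebra generated by $T$ and $T^*$. Put $T_{n,m}=T^nT^{*m}$ for $n,m\in\mathbb{Z}_+$. Let $\mathcal{T}\otimes\mathcal{T}$ be the minimal $C^*$-tensor product and let $\Delta\colon\mathcal{T}\to\mathcal{T}\otimes\mathcal{T}$ be the unique unital $*$-homomorphism with $\Delta(T)=T\otimes T$. For bounded linear functionals $\rho,\varphi\in\mathcal{T}^*$ let $\rho*\varphi=(\rho\otimes\varphi)\circ\Delta\in\mathcal{T}^*$. A state $h\in\mathcal{T}^*$ (a positive linear functional of norm one) is called a Haar functional if for every $\rho\in\mathcal{T}^*$ there is $\lambda_\rho\in\mathbb{C}$ with $h*\rho=\rho*h=\lambda_\rho h$. Theorem. A state $h$ on $\mathcal{T}$ is a Haar functional if and only if $h(T_{0,0})=1$ and $h(T_{n,m})=0$ for all $(n,m)\neq(0,0)$. A Haar functional exists, and every Haar functional $h$ is the vector state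 $h(A)=\langle Ae_0,e_0\rangle$, $A\in\mathcal{T}$. -/

import Mathlib

open scoped TensorProduct ENNReal ComplexOrder

noncomputable section

namespace QSemigroup

/-! ### The minimal (spatial) tensor product of two concrete C*-algebras -/

section Spatial

variable {H : Type*} [NormedAddCommGroup H] [InnerProductSpace ℂ H]
variable {K : Type*} [NormedAddCommGroup K] [InnerProductSpace ℂ K]

/-- The Hilbert space tensor product: the completion of the algebraic tensor product with respect
to the norm of the inner product `⟪x ⊗ y, x' ⊗ y'⟫ = ⟪x, x'⟫ ⟪y, y'⟫`. -/
def HilbertTensor (H K : Type*) [NormedAddCommGroup H] [InnerProductSpace ℂ H]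
    [NormedAddCommGroup K] [InnerProductSpace ℂ K] : Type _ :=
  UniformSpace.Completion (H ⊗[ℂ] K)

instance : NormedAddCommGroup (HilbertTensor H K) :=
  inferInstanceAs (NormedAddCommGroup (UniformSpace.Completion (H ⊗[ℂ] K)))

instance : InnerProductSpace ℂ (HilbertTensor H K) :=
  inferInstanceAs (InnerProductSpace ℂ (UniformSpace.Completion (H ⊗[ℂ] K)))

instance : CompleteSpace (HilbertTensor H K) :=
  inferInstanceAs (CompleteSpace (UniformSpace.Completion (H ⊗[ℂ] K)))

/-- The canonical isometric embedding of the algebraic tensor product. -/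
def ofAlg : (H ⊗[ℂ] K) →ₗᵢ[ℂ] HilbertTensor H K :=
  (UniformSpace.Completion.toComplₗᵢ : (H ⊗[ℂ] K) →ₗᵢ[ℂ] UniformSpace.Completion (H ⊗[ℂ] K))

/-- The elementary tensor `x ⊗ y` in the Hilbert space tensor product. -/
def vtmul (x : H) (y : K) : HilbertTensor H K := ofAlg (x ⊗ₜ[ℂ] y)

/-- The operator `A ⊗ B` on the Hilbert space tensor product, `(A ⊗ B) (x ⊗ y) = A x ⊗ B y`. -/
def opTensor (A : H →L[ℂ] H) (B : K →L[ℂ] K) : HilbertTensor H K →L[ℂ] HilbertTensor H K :=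
  (TensorProduct.mapL A B).completion

theorem dense_ofAlg : DenseRange (ofAlg : H ⊗[ℂ] K → HilbertTensor H K) :=
  UniformSpace.Completion.denseRange_coe

theorem opTensor_vtmul (A : H →L[ℂ] H) (B : K →L[ℂ] K) (x : H) (y : K) :
    opTensor A B (vtmul x y) = vtmul (A x) (B y) :=
  (TensorProduct.mapL A B).completion_apply_coe (x ⊗ₜ[ℂ] y)

theorem inner_vtmul (x x' : H) (y y' : K) :
    inner ℂ (vtmul x y) (vtmul x' y') = inner ℂ x x' * inner ℂ y y' := by
  simp [vtmul]

theorem norm_vtmul (x : H) (y : K) : ‖vtmul x y‖ = ‖x‖ * ‖y‖ := by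
  simp [vtmul]

theorem vtmul_add_left (x x' : H) (y : K) : vtmul (x + x') y = vtmul x y + vtmul x' y := by
  simp [vtmul, TensorProduct.add_tmul]

theorem vtmul_add_right (x : H) (y y' : K) : vtmul x (y + y') = vtmul x y + vtmul x y' := by
  simp [vtmul, TensorProduct.tmul_add]

theorem vtmul_smul_left (c : ℂ) (x : H) (y : K) : vtmul (c • x) y = c • vtmul x y := by
  rw [vtmul, vtmul, ← map_smul, TensorProduct.smul_tmul']

theorem vtmul_smul_right (c : ℂ) (x : H) (y : K) : vtmul x (c • y) = c • vtmul x y := by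
  rw [vtmul, vtmul, ← map_smul, TensorProduct.tmul_smul]

/-- The elementary tensors are total. -/
theorem dense_span_vtmul :
    (Submodule.span ℂ {v : HilbertTensor H K | ∃ x y, v = vtmul x y}).topologicalClosure = ⊤ := by
  rw [eq_top_iff]
  rintro v -
  refine dense_ofAlg.induction_on v (Submodule.isClosed_topologicalClosure _) ?_
  intro t
  refine Submodule.le_topologicalClosure _ ?_
  induction t with
  | zero => rw [map_zero]; exact Submodule.zero_mem _
  | tmul x y => exact Submodule.subset_span ⟨x, y, rfl⟩
  | add a b ha hb => rw [map_add]; exact Submodule.add_mem _ ha hb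

theorem clm_ext_vtmul {M : Type*} [NormedAddCommGroup M] [NormedSpace ℂ M]
    {f g : HilbertTensor H K →L[ℂ] M} (h : ∀ x y, f (vtmul x y) = g (vtmul x y)) : f = g := by
  refine ContinuousLinearMap.ext_on (s := {v : HilbertTensor H K | ∃ x y, v = vtmul x y}) ?_ ?_
  · intro v
    have := (dense_span_vtmul (H := H) (K := K)).ge (Submodule.mem_top (x := v))
    exact this
  · rintro v ⟨x, y, rfl⟩
    exact h x y

theorem opTensor_mul (A A' : H →L[ℂ] H) (B B' : K →L[ℂ] K) :
    opTensor (A * A') (B * B') = opTensor A B * opTensor A' B' :=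
  clm_ext_vtmul fun x y => by simp [opTensor_vtmul]

theorem opTensor_one : opTensor (1 : H →L[ℂ] H) (1 : K →L[ℂ] K) = 1 :=
  clm_ext_vtmul fun x y => by simp [opTensor_vtmul]

theorem opTensor_add_left (A A' : H →L[ℂ] H) (B : K →L[ℂ] K) :
    opTensor (A + A') B = opTensor A B + opTensor A' B :=
  clm_ext_vtmul fun x y => by simp [opTensor_vtmul, vtmul_add_left]

theorem opTensor_add_right (A : H →L[ℂ] H) (B B' : K →L[ℂ] K) :
    opTensor A (B + B') = opTensor A B + opTensor A B' :=
  clm_ext_vtmul fun x y => by simp [opTensor_vtmul, vtmul_add_right]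

theorem opTensor_smul_left (c : ℂ) (A : H →L[ℂ] H) (B : K →L[ℂ] K) :
    opTensor (c • A) B = c • opTensor A B :=
  clm_ext_vtmul fun x y => by simp [opTensor_vtmul, vtmul_smul_left]

theorem opTensor_smul_right (c : ℂ) (A : H →L[ℂ] H) (B : K →L[ℂ] K) :
    opTensor A (c • B) = c • opTensor A B :=
  clm_ext_vtmul fun x y => by simp [opTensor_vtmul, vtmul_smul_right]

theorem opTensor_star [CompleteSpace H] [CompleteSpace K] (A : H →L[ℂ] H) (B : K →L[ℂ] K) :
    star (opTensor A B) = opTensor (star A) (star B) := by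
  refine clm_ext_vtmul fun x y => ?_
  refine ext_inner_right ℂ fun v => ?_
  rw [ContinuousLinearMap.star_eq_adjoint, ContinuousLinearMap.adjoint_inner_left]
  have : (innerSL ℂ (vtmul x y)).comp (opTensor A B)
      = innerSL ℂ (opTensor (star A) (star B) (vtmul x y)) := by
    refine clm_ext_vtmul fun x' y' => ?_
    simp [opTensor_vtmul, inner_vtmul, ContinuousLinearMap.star_eq_adjoint,
      ContinuousLinearMap.adjoint_inner_left]
  simpa using congrArg (fun f => f v) this

theorem opNorm_le_of_inner {A : H →L[ℂ] H} {C : ℝ} (hC : 0 ≤ C)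
    (h : ∀ x y, ‖inner ℂ x (A y)‖ ≤ C * (‖x‖ * ‖y‖)) : ‖A‖ ≤ C := by
  refine ContinuousLinearMap.opNorm_le_bound _ hC fun y => ?_
  rcases (norm_nonneg (A y)).eq_or_lt with h0 | h0
  · rw [← h0]; positivity
  have h1 := h (A y) y
  rw [inner_self_eq_norm_sq_to_K, norm_pow, RCLike.norm_ofReal, abs_norm] at h1
  exact le_of_mul_le_mul_left (by linarith) h0

variable [CompleteSpace H] [CompleteSpace K]

/-- The minimal tensor product of two C*-algebras of operators on Hilbert spaces: the C*-algebra
of operators on the Hilbert space tensor product generated by the operators `A ⊗ B`. -/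
def minTensor (𝒜 : StarSubalgebra ℂ (H →L[ℂ] H)) (ℬ : StarSubalgebra ℂ (K →L[ℂ] K)) :
    StarSubalgebra ℂ (HilbertTensor H K →L[ℂ] HilbertTensor H K) :=
  (StarAlgebra.adjoin ℂ {u | ∃ A ∈ 𝒜, ∃ B ∈ ℬ, u = opTensor A B}).topologicalClosure

/-! Shortcut instances, for the speed of instance search only. -/

instance (S : StarSubalgebra ℂ (H →L[ℂ] H)) : NormedRing S := inferInstance
instance (S : StarSubalgebra ℂ (H →L[ℂ] H)) : NormedAddCommGroup S := inferInstance
instance (S : StarSubalgebra ℂ (H →L[ℂ] H)) : SeminormedAddCommGroup S := inferInstance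
instance (S : StarSubalgebra ℂ (H →L[ℂ] H)) : AddCommGroup S := inferInstance
instance (S : StarSubalgebra ℂ (H →L[ℂ] H)) : AddCommMonoid S := inferInstance
instance (S : StarSubalgebra ℂ (H →L[ℂ] H)) : NormedSpace ℂ S := inferInstance
instance (S : StarSubalgebra ℂ (H →L[ℂ] H)) : Module ℂ S := inferInstance

variable {𝒜 : StarSubalgebra ℂ (H →L[ℂ] H)} {ℬ : StarSubalgebra ℂ (K →L[ℂ] K)}

/-- The elementary tensor `A ⊗ B` as an element of the minimal tensor product. -/
def tmul (A : 𝒜) (B : ℬ) : minTensor 𝒜 ℬ :=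
  ⟨opTensor (A : H →L[ℂ] H) (B : K →L[ℂ] K),
    StarSubalgebra.le_topologicalClosure _
      (StarAlgebra.subset_adjoin ℂ _ ⟨A, A.2, B, B.2, rfl⟩)⟩

theorem isClosed_minTensor : IsClosed ((minTensor 𝒜 ℬ : StarSubalgebra ℂ _) :
    Set (HilbertTensor H K →L[ℂ] HilbertTensor H K)) :=
  StarSubalgebra.isClosed_topologicalClosure _

/-- The canonical map from the algebraic to the minimal tensor product. -/
def toMin (𝒜 : StarSubalgebra ℂ (H →L[ℂ] H)) (ℬ : StarSubalgebra ℂ (K →L[ℂ] K)) :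
    𝒜 ⊗[ℂ] ℬ →ₗ[ℂ] minTensor 𝒜 ℬ :=
  TensorProduct.lift <| LinearMap.mk₂ ℂ tmul
    (fun _ _ _ => Subtype.ext (opTensor_add_left _ _ _))
    (fun _ _ _ => Subtype.ext (opTensor_smul_left _ _ _))
    (fun _ _ _ => Subtype.ext (opTensor_add_right _ _ _))
    (fun _ _ _ => Subtype.ext (opTensor_smul_right _ _ _))

theorem toMin_tmul (A : 𝒜) (B : ℬ) : toMin 𝒜 ℬ (A ⊗ₜ[ℂ] B) = tmul A B := by
  simp [toMin]

/-- The linear combinations of elementary tensors are dense in the minimal tensor product. -/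
theorem dense_range_toMin : DenseRange (toMin 𝒜 ℬ) := by
  set S : Set (HilbertTensor H K →L[ℂ] HilbertTensor H K) :=
    {u | ∃ A ∈ 𝒜, ∃ B ∈ ℬ, u = opTensor A B} with hS
  have hstar : S ∪ star S = S := by
    refine Set.union_eq_left.2 ?_
    rintro u ⟨A, hA, B, hB, h⟩
    refine ⟨star A, star_mem hA, star B, star_mem hB, ?_⟩
    rw [← opTensor_star, ← h, star_star]
  let N : Submonoid (HilbertTensor H K →L[ℂ] HilbertTensor H K) :=
    { carrier := S
      one_mem' := ⟨1, one_mem _, 1, one_mem _, opTensor_one.symm⟩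
      mul_mem' := by
        rintro _ _ ⟨A, hA, B, hB, rfl⟩ ⟨A', hA', B', hB', rfl⟩
        exact ⟨A * A', mul_mem hA hA', B * B', mul_mem hB hB', (opTensor_mul _ _ _ _).symm⟩ }
  have hspan : ∀ u ∈ StarAlgebra.adjoin ℂ S, u ∈ Submodule.span ℂ S := by
    intro u hu
    have h1 : u ∈ Subalgebra.toSubmodule (Algebra.adjoin ℂ S) := by
      have h2 := StarAlgebra.adjoin_toSubalgebra ℂ S
      rw [hstar] at h2
      rw [← h2]
      exact hu
    have hN : Submonoid.closure S = N := Submonoid.closure_eq N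
    rw [Algebra.adjoin_eq_span, hN] at h1
    exact h1
  have hrange : ∀ u ∈ Submodule.span ℂ S, ∃ t, (toMin 𝒜 ℬ t : _ →L[ℂ] _) = u := by
    intro u hu
    induction hu using Submodule.span_induction with
    | mem u hu =>
      obtain ⟨A, hA, B, hB, rfl⟩ := hu
      exact ⟨(⟨A, hA⟩ : 𝒜) ⊗ₜ[ℂ] (⟨B, hB⟩ : ℬ), by rw [toMin_tmul]; rfl⟩
    | zero => exact ⟨0, by simp⟩
    | add u v _ _ hu hv =>
      obtain ⟨s, rfl⟩ := hu
      obtain ⟨t, rfl⟩ := hv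
      exact ⟨s + t, by simp⟩
    | smul c u _ hu =>
      obtain ⟨s, rfl⟩ := hu
      exact ⟨c • s, by simp⟩
  intro u
  rw [closure_subtype]
  refine closure_mono ?_ u.2
  intro v hv
  obtain ⟨t, rfl⟩ := hrange v (hspan v hv)
  exact ⟨_, ⟨t, rfl⟩, rfl⟩

/-- The functional `ρ ⊗ φ` on the algebraic tensor product. -/
def algFunctional (ρ : StrongDual ℂ 𝒜) (φ : StrongDual ℂ ℬ) : 𝒜 ⊗[ℂ] ℬ →ₗ[ℂ] ℂ :=
  TensorProduct.lift (((LinearMap.mul ℂ ℂ).compl₂ φ.toLinearMap).comp ρ.toLinearMap)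

theorem algFunctional_tmul (ρ : StrongDual ℂ 𝒜) (φ : StrongDual ℂ ℬ) (A : 𝒜) (B : ℬ) :
    algFunctional ρ φ (A ⊗ₜ[ℂ] B) = ρ A * φ B := by
  simp [algFunctional]

/-- The slice map `A ⊗ B ↦ ρ(A) B`. -/
def sliceL (ρ : 𝒜 →ₗ[ℂ] ℂ) : 𝒜 ⊗[ℂ] ℬ →ₗ[ℂ] ℬ :=
  (TensorProduct.lid ℂ ℬ).toLinearMap ∘ₗ LinearMap.rTensor ℬ ρ

/-- The slice map `A ⊗ B ↦ φ(B) A`. -/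
def sliceR (φ : ℬ →ₗ[ℂ] ℂ) : 𝒜 ⊗[ℂ] ℬ →ₗ[ℂ] 𝒜 :=
  (TensorProduct.rid ℂ 𝒜).toLinearMap ∘ₗ LinearMap.lTensor 𝒜 φ

/-- The matrix coefficient `B ↦ ⟪x, B y⟫`. -/
def coeff (ℬ : StarSubalgebra ℂ (K →L[ℂ] K)) (x y : K) : ℬ →ₗ[ℂ] ℂ where
  toFun B := inner ℂ x ((B : K →L[ℂ] K) y)
  map_add' := by intros; simp
  map_smul' := by intros; simp

theorem norm_sliceR_coeff (x y : K) (t : 𝒜 ⊗[ℂ] ℬ) :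
    ‖sliceR (coeff ℬ x y) t‖ ≤ ‖toMin 𝒜 ℬ t‖ * (‖x‖ * ‖y‖) := by
  change ‖(sliceR (coeff ℬ x y) t : H →L[ℂ] H)‖ ≤ _
  refine opNorm_le_of_inner (by positivity) fun p q => ?_
  have key : inner ℂ p ((sliceR (coeff ℬ x y) t : H →L[ℂ] H) q)
      = inner ℂ (vtmul p x) ((toMin 𝒜 ℬ t : _ →L[ℂ] _) (vtmul q y)) := by
    induction t with
    | zero => simp
    | tmul A B =>
      rw [toMin_tmul]
      simp [sliceR, coeff, tmul, opTensor_vtmul, inner_vtmul, mul_comm]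
    | add a b ha hb => simp [ha, hb]
  rw [key]
  calc _ ≤ ‖vtmul p x‖ * ‖(toMin 𝒜 ℬ t : _ →L[ℂ] _) (vtmul q y)‖ := norm_inner_le_norm _ _
    _ ≤ ‖vtmul p x‖ * (‖toMin 𝒜 ℬ t‖ * ‖vtmul q y‖) := by
        gcongr
        exact ContinuousLinearMap.le_opNorm _ _
    _ = _ := by rw [norm_vtmul, norm_vtmul]; ring

theorem norm_sliceL (ρ : StrongDual ℂ 𝒜) (t : 𝒜 ⊗[ℂ] ℬ) :
    ‖sliceL ρ.toLinearMap t‖ ≤ ‖ρ‖ * ‖toMin 𝒜 ℬ t‖ := by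
  change ‖(sliceL ρ.toLinearMap t : K →L[ℂ] K)‖ ≤ _
  refine opNorm_le_of_inner (by positivity) fun x y => ?_
  have key : inner ℂ x ((sliceL ρ.toLinearMap t : K →L[ℂ] K) y)
      = ρ (sliceR (coeff ℬ x y) t) := by
    induction t with
    | zero => simp
    | tmul A B => simp [sliceR, sliceL, coeff, mul_comm]
    | add a b ha hb => simp [ha, hb]
  rw [key]
  calc _ ≤ ‖ρ‖ * ‖sliceR (coeff ℬ x y) t‖ := ρ.le_opNorm _
    _ ≤ ‖ρ‖ * (‖toMin 𝒜 ℬ t‖ * (‖x‖ * ‖y‖)) := by gcongr; exact norm_sliceR_coeff x y t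
    _ = _ := by ring

theorem norm_algFunctional (ρ : StrongDual ℂ 𝒜) (φ : StrongDual ℂ ℬ) (t : 𝒜 ⊗[ℂ] ℬ) :
    ‖algFunctional ρ φ t‖ ≤ (‖ρ‖ * ‖φ‖) * ‖toMin 𝒜 ℬ t‖ := by
  have key : algFunctional ρ φ t = φ (sliceL ρ.toLinearMap t) := by
    induction t with
    | zero => simp
    | tmul A B => simp [sliceL, algFunctional_tmul]
    | add a b ha hb => simp [ha, hb]
  rw [key]
  calc _ ≤ ‖φ‖ * ‖sliceL ρ.toLinearMap t‖ := φ.le_opNorm _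
    _ ≤ ‖φ‖ * (‖ρ‖ * ‖toMin 𝒜 ℬ t‖) := by gcongr; exact norm_sliceL ρ t
    _ = _ := by ring

theorem existsUnique_extension {E F : Type*} [AddCommGroup E] [Module ℂ E]
    [NormedAddCommGroup F] [NormedSpace ℂ F] (f : E →ₗ[ℂ] ℂ) (e : E →ₗ[ℂ] F) (he : DenseRange e)
    (C : ℝ) (hC : ∀ t, ‖f t‖ ≤ C * ‖e t‖) : ∃! Φ : F →L[ℂ] ℂ, ∀ t, Φ (e t) = f t := by
  refine ⟨f.extendOfNorm e, fun t => LinearMap.extendOfNorm_eq he ⟨C, hC⟩ t, fun Ψ hΨ => ?_⟩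
  exact (LinearMap.extendOfNorm_unique he C hC Ψ (LinearMap.ext hΨ)).symm

/-- Bounded functionals `ρ`, `φ` have a unique bounded tensor product on the minimal tensor
product. -/
theorem existsUnique_tensorFunctional (ρ : StrongDual ℂ 𝒜) (φ : StrongDual ℂ ℬ) :
    ∃! Φ : StrongDual ℂ (minTensor 𝒜 ℬ), ∀ (A : 𝒜) (B : ℬ), Φ (tmul A B) = ρ A * φ B := by
  obtain ⟨Φ, h, hu⟩ := existsUnique_extension (algFunctional ρ φ) (toMin 𝒜 ℬ) dense_range_toMin _
    (norm_algFunctional ρ φ)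
  refine ⟨Φ, fun A B => ?_, fun Ψ hΨ => hu Ψ fun t => ?_⟩
  · rw [← toMin_tmul, h, algFunctional_tmul]
  · induction t with
    | zero => rw [map_zero, map_zero, map_zero]
    | tmul A B => rw [toMin_tmul, algFunctional_tmul, hΨ]
    | add a b ha hb => rw [map_add, map_add, map_add, ha, hb]

/-- The tensor product `ρ ⊗ φ` of bounded functionals: the bounded functional on the minimal
tensor product with `(ρ ⊗ φ) (A ⊗ B) = ρ(A) φ(B)`. -/
def tensorFunctional (ρ : StrongDual ℂ 𝒜) (φ : StrongDual ℂ ℬ) : StrongDual ℂ (minTensor 𝒜 ℬ) :=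
  (existsUnique_tensorFunctional ρ φ).choose

theorem tensorFunctional_tmul (ρ : StrongDual ℂ 𝒜) (φ : StrongDual ℂ ℬ) (A : 𝒜) (B : ℬ) :
    tensorFunctional ρ φ (tmul A B) = ρ A * φ B :=
  (existsUnique_tensorFunctional ρ φ).choose_spec.1 A B

end Spatial

/-! ### The Toeplitz algebra -/

/-- The Hilbert space `ℓ²` of square summable complex functions on the nonnegative integers. -/
abbrev L2 : Type := lp (fun _ : ℕ => ℂ) 2

/-- The standard basis vector `e n`. -/
def e (n : ℕ) : L2 := lp.single 2 n (1 : ℂ)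

/-- The sequence `(0, f 0, f 1, …)`. -/
def shiftFun (f : ℕ → ℂ) : ℕ → ℂ
  | 0 => 0
  | n + 1 => f n

theorem hasSum_shiftFun (f : L2) :
    HasSum (fun n => ‖shiftFun f n‖ ^ (2 : ℝ≥0∞).toReal) (‖f‖ ^ (2 : ℝ≥0∞).toReal) := by
  have h := lp.hasSum_norm (p := 2) (by norm_num) f
  rw [← hasSum_nat_add_iff' 1]
  simpa [shiftFun] using h

/-- The right shift `(f 0, f 1, …) ↦ (0, f 0, f 1, …)`, as an isometry. -/
def shiftIsometry : L2 →ₗᵢ[ℂ] L2 where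
  toFun f := ⟨shiftFun f, memℓp_gen (hasSum_shiftFun f).summable⟩
  map_add' f g := by
    ext n
    change shiftFun (f + g : L2) n = shiftFun f n + shiftFun g n
    cases n <;> simp [shiftFun]
  map_smul' c f := by
    ext n
    cases n <;> simp [shiftFun]
  norm_map' f := by
    have h1 := lp.hasSum_norm (p := 2) (by norm_num)
      (⟨shiftFun f, memℓp_gen (hasSum_shiftFun f).summable⟩ : L2)
    have h2 := h1.unique (hasSum_shiftFun f)
    exact (Real.rpow_left_inj (norm_nonneg _) (norm_nonneg _) (by norm_num)).1 h2

/-- The right shift operator `T`. -/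
def shift : L2 →L[ℂ] L2 := shiftIsometry.toContinuousLinearMap

theorem shift_e (n : ℕ) : shift (e n) = e (n + 1) := by
  ext m
  change shiftFun (e n) m = e (n + 1) m
  cases m <;> simp [shiftFun, e, Pi.single_apply]

/-- The Toeplitz algebra: the norm closed *-algebra generated by the right shift. -/
def Toeplitz : StarSubalgebra ℂ (L2 →L[ℂ] L2) := StarAlgebra.elemental ℂ shift

/-- The generator `T` of the Toeplitz algebra. -/
def T : Toeplitz := ⟨shift, StarAlgebra.elemental.self_mem ℂ shift⟩

/-- The operators `T_{n,m} = T ^ n T* ^ m`. -/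
def Tnm (n m : ℕ) : Toeplitz := T ^ n * star T ^ m

/-! ### The comultiplication -/

/-- The Hilbert basis `e n`. -/
def eBasis : HilbertBasis ℕ ℂ L2 := HilbertBasis.ofRepr (LinearIsometryEquiv.refl ℂ _)

theorem eBasis_apply (n : ℕ) : eBasis n = e n := by
  rw [← HilbertBasis.repr_symm_single]
  rfl

section Basis

variable {H : Type*} [NormedAddCommGroup H] [InnerProductSpace ℂ H]
variable {K : Type*} [NormedAddCommGroup K] [InnerProductSpace ℂ K]
variable {ι κ : Type*}

theorem mem_of_basis {M : Type*} [NormedAddCommGroup M] [NormedSpace ℂ M]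
    (S : Submodule ℂ M) (hc : IsClosed (S : Set M)) (d : HilbertBasis ι ℂ H) (f : H →L[ℂ] M)
    (hf : ∀ i, f (d i) ∈ S) (x : H) : f x ∈ S :=
  hc.mem_of_tendsto (f.hasSum (d.hasSum_repr x)) (Filter.Eventually.of_forall fun s =>
    Submodule.sum_mem _ fun i _ => by
      simp only [map_smul]
      exact Submodule.smul_mem _ _ (hf i))

theorem orthonormal_vtmul (b : HilbertBasis ι ℂ H) (c : HilbertBasis κ ℂ K) :
    Orthonormal ℂ fun p : ι × κ => vtmul (b p.1) (c p.2) :=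
  (b.orthonormal.tmul c.orthonormal).comp_linearIsometry ofAlg

/-- The tensor product of two Hilbert bases. -/
def tensorBasis (b : HilbertBasis ι ℂ H) (c : HilbertBasis κ ℂ K) :
    HilbertBasis (ι × κ) ℂ (HilbertTensor H K) :=
  HilbertBasis.mk (orthonormal_vtmul b c) <| by
  set S := (Submodule.span ℂ
    (Set.range fun p : ι × κ => vtmul (b p.1) (c p.2))).topologicalClosure with hS
  have hc : IsClosed (S : Set (HilbertTensor H K)) := Submodule.isClosed_topologicalClosure _
  have h1 : ∀ i y, vtmul (b i) y ∈ S := fun i =>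
    mem_of_basis S hc c (ofAlg.toContinuousLinearMap ∘L TensorProduct.mkL ℂ H K (b i)) fun j =>
      Submodule.le_topologicalClosure _ (Submodule.subset_span ⟨(i, j), rfl⟩)
  have h2 : ∀ x y, vtmul x y ∈ S := by
    intro x y
    exact mem_of_basis S hc b (ofAlg.toContinuousLinearMap ∘L (TensorProduct.mkL ℂ H K).flip y)
      (fun i => h1 i y) x
  rw [← dense_span_vtmul (H := H) (K := K)]
  refine Submodule.topologicalClosure_minimal _ (Submodule.span_le.2 ?_) hc
  rintro v ⟨x, y, rfl⟩
  exact h2 x y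

theorem tensorBasis_apply (b : HilbertBasis ι ℂ H) (c : HilbertBasis κ ℂ K) (p : ι × κ) :
    tensorBasis b c p = vtmul (b p.1) (c p.2) := by
  rw [tensorBasis, HilbertBasis.coe_mk]

theorem clm_ext_basis {M : Type*} [NormedAddCommGroup M] [NormedSpace ℂ M]
    (b : HilbertBasis ι ℂ H) {f g : H →L[ℂ] M} (h : ∀ i, f (b i) = g (b i)) : f = g := by
  refine ContinuousLinearMap.ext_on (s := Set.range b) ?_ ?_
  · intro v
    exact b.dense_span.ge (Submodule.mem_top (x := v))
  · rintro v ⟨i, rfl⟩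
    exact h i

end Basis

/-- The Hilbert space `ℓ²(ℤ)`. -/
abbrev L2Z : Type := lp (fun _ : ℤ => ℂ) 2

/-- The standard Hilbert basis of `ℓ²(ℤ)`. -/
def fBasis : HilbertBasis ℤ ℂ L2Z := HilbertBasis.ofRepr (LinearIsometryEquiv.refl ℂ _)

/-- The bijection `(i, j) ↦ (min i j, i - j)`. -/
def diagEquiv : ℕ × ℕ ≃ ℕ × ℤ where
  toFun p := (min p.1 p.2, (p.1 : ℤ) - p.2)
  invFun q := (q.1 + q.2.toNat, q.1 + (-q.2).toNat)
  left_inv p := by ext <;> simp <;> omega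
  right_inv q := by ext <;> simp; omega

theorem diagEquiv_succ (i j : ℕ) :
    diagEquiv (i + 1, j + 1) = ((diagEquiv (i, j)).1 + 1, (diagEquiv (i, j)).2) := by
  ext <;> simp [diagEquiv]

/-- The Hilbert basis `e i ⊗ e j`, indexed by `(min i j, i - j)`. -/
def diagBasis : HilbertBasis (ℕ × ℤ) ℂ (HilbertTensor L2 L2) :=
  HilbertBasis.mk (v := tensorBasis eBasis eBasis ∘ diagEquiv.symm)
    ((tensorBasis eBasis eBasis).orthonormal.comp _ diagEquiv.symm.injective) <| by
  rw [diagEquiv.symm.surjective.range_comp, HilbertBasis.dense_span]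

theorem diagBasis_apply (i j : ℕ) : diagBasis (diagEquiv (i, j)) = vtmul (e i) (e j) := by
  rw [diagBasis, HilbertBasis.coe_mk, Function.comp_apply, Equiv.symm_apply_apply,
    tensorBasis_apply, eBasis_apply, eBasis_apply]

/-- The unitary `ℓ² ⊗ ℓ²(ℤ) → ℓ² ⊗ ℓ²` which identifies `T ⊗ 1` with `T ⊗ T`. -/
def diagUnitary : HilbertTensor L2 L2Z ≃ₗᵢ[ℂ] HilbertTensor L2 L2 :=
  (tensorBasis eBasis fBasis).repr.trans diagBasis.repr.symm

theorem diagUnitary_apply (q : ℕ × ℤ) :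
    diagUnitary (vtmul (e q.1) (fBasis q.2)) = diagBasis q := by
  classical
  rw [← eBasis_apply, ← tensorBasis_apply eBasis fBasis q, diagUnitary,
    LinearIsometryEquiv.trans_apply, HilbertBasis.repr_self, HilbertBasis.repr_symm_single]

/-- The *-homomorphism `A ↦ A ⊗ 1`. -/
def ampliation : (L2 →L[ℂ] L2) →⋆ₐ[ℂ] (HilbertTensor L2 L2Z →L[ℂ] HilbertTensor L2 L2Z) where
  toFun A := opTensor A 1
  map_one' := opTensor_one
  map_mul' A B := by
    have h := opTensor_mul A B (1 : L2Z →L[ℂ] L2Z) 1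
    rwa [mul_one] at h
  map_zero' := by
    have h := opTensor_smul_left 0 (0 : L2 →L[ℂ] L2) (1 : L2Z →L[ℂ] L2Z)
    rwa [zero_smul, zero_smul] at h
  map_add' A B := opTensor_add_left A B 1
  commutes' c := by
    rw [Algebra.algebraMap_eq_smul_one, Algebra.algebraMap_eq_smul_one, opTensor_smul_left,
      opTensor_one]
  map_star' A := by
    rw [opTensor_star, star_one]

/-- The *-homomorphism `A ↦ W (A ⊗ 1) W*` on all bounded operators, with `W` the unitary above. -/
def comulAux : (L2 →L[ℂ] L2) →⋆ₐ[ℂ] (HilbertTensor L2 L2 →L[ℂ] HilbertTensor L2 L2) :=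
  diagUnitary.conjStarAlgEquiv.toStarAlgHom.comp ampliation

theorem comulAux_shift : comulAux shift = opTensor shift shift := by
  refine clm_ext_basis diagBasis fun q => ?_
  obtain ⟨⟨i, j⟩, rfl⟩ := diagEquiv.surjective q
  have h : comulAux shift (diagBasis (diagEquiv (i, j)))
      = diagUnitary (opTensor shift 1 (diagUnitary.symm (diagBasis (diagEquiv (i, j))))) := rfl
  rw [h, ← diagUnitary_apply, LinearIsometryEquiv.symm_apply_apply, opTensor_vtmul, shift_e,
    diagUnitary_apply, diagBasis_apply, opTensor_vtmul, shift_e, shift_e, ← diagBasis_apply,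
    diagEquiv_succ, ← diagUnitary_apply]
  rfl

theorem continuous_starAlgHom {H K : Type*} [NormedAddCommGroup H] [InnerProductSpace ℂ H]
    [CompleteSpace H] [NormedAddCommGroup K] [InnerProductSpace ℂ K] [CompleteSpace K]
    {S : StarSubalgebra ℂ (H →L[ℂ] H)} {S' : StarSubalgebra ℂ (K →L[ℂ] K)}
    (hS : IsClosed (S : Set (H →L[ℂ] H))) (hS' : IsClosed (S' : Set (K →L[ℂ] K)))
    (f : S →⋆ₐ[ℂ] S') : Continuous f := by
  let _ : CStarAlgebra S := StarSubalgebra.cstarAlgebra S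
  let _ : CStarAlgebra S' := StarSubalgebra.cstarAlgebra S'
  exact AddMonoidHomClass.continuous_of_bound f 1 fun a => by
    rw [one_mul]
    exact NonUnitalStarAlgHom.norm_apply_le f a

theorem comulAux_mem (A : Toeplitz) :
    comulAux (A : L2 →L[ℂ] L2) ∈ minTensor Toeplitz Toeplitz := by
  have hcont : Continuous comulAux :=
    AddMonoidHomClass.continuous_of_bound comulAux 1 fun a => by
      rw [one_mul]
      exact NonUnitalStarAlgHom.norm_apply_le comulAux a
  have hle : Toeplitz ≤ (minTensor Toeplitz Toeplitz).comap comulAux := by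
    refine StarAlgebra.elemental.le_of_mem (isClosed_minTensor.preimage hcont) ?_
    rw [StarSubalgebra.mem_comap, comulAux_shift]
    exact (tmul T T).2
  exact hle A.2

/-- There is exactly one unital *-homomorphism from the Toeplitz algebra to its minimal tensor
square which maps `T` to `T ⊗ T`. -/
theorem existsUnique_comul :
    ∃! Δ : Toeplitz →⋆ₐ[ℂ] minTensor Toeplitz Toeplitz, Δ T = tmul T T := by
  refine ⟨(comulAux.comp Toeplitz.subtype).codRestrict _ comulAux_mem, ?_, fun Δ hΔ => ?_⟩
  · exact Subtype.ext comulAux_shift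
  · have hc : IsClosed (Toeplitz : Set (L2 →L[ℂ] L2)) := StarAlgebra.elemental.isClosed ℂ shift
    refine StarAlgebra.elemental.starAlgHomClass_ext ℂ
      (continuous_starAlgHom hc isClosed_minTensor _)
      (continuous_starAlgHom hc isClosed_minTensor _) ?_
    exact hΔ.trans (Subtype.ext comulAux_shift).symm

/-- The comultiplication `Δ` of the Toeplitz algebra: the unital *-homomorphism to the minimal
tensor square with `Δ(T) = T ⊗ T`. -/
def comul : Toeplitz →⋆ₐ[ℂ] minTensor Toeplitz Toeplitz := existsUnique_comul.choose

theorem comul_T : comul T = tmul T T := existsUnique_comul.choose_spec.1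

theorem continuous_comul : Continuous comul :=
  continuous_starAlgHom (StarAlgebra.elemental.isClosed ℂ shift) isClosed_minTensor comul

/-- The comultiplication as a bounded linear map. -/
def comulL : Toeplitz →L[ℂ] minTensor Toeplitz Toeplitz where
  toFun := comul
  map_add' := map_add comul
  map_smul' := map_smul comul
  cont := continuous_comul

/-! ### The dual algebra, states and Haar functionals -/

/-- The product `ρ ∗ φ = (ρ ⊗ φ) ∘ Δ` of bounded functionals on the Toeplitz algebra. -/
def conv (ρ φ : StrongDual ℂ Toeplitz) : StrongDual ℂ Toeplitz :=
  (tensorFunctional ρ φ).comp comulL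

/-- A state: a positive linear functional of norm one. -/
def IsState (h : StrongDual ℂ Toeplitz) : Prop :=
  (∀ A : Toeplitz, 0 ≤ h (star A * A)) ∧ ‖h‖ = 1

/-- A Haar functional: a state `h` such that for each bounded functional `ρ` both products
`h ∗ ρ` and `ρ ∗ h` are equal to one and the same scalar multiple of `h`. -/
def IsHaar (h : StrongDual ℂ Toeplitz) : Prop :=
  IsState h ∧ ∀ ρ : StrongDual ℂ Toeplitz, ∃ c : ℂ, conv h ρ = c • h ∧ conv ρ h = c • h

end QSemigroup

end

open scoped TensorProduct ENNReal ComplexOrder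

noncomputable section

namespace QSemigroup

/-! ### States on C*-algebras -/

/-! Every `Tnm n m` is group-like: `Δ(T_{n,m}) = T_{n,m} ⊗ T_{n,m}` (`comul_Tnm`). Convolution of
functionals is therefore pointwise multiplication of their values at these operators (`conv_Tnm`).
Since `T* T = 1`, the operators `T_{n,m}` are closed under products, so their span is dense
(`dense_span_Tnm`) and those values determine a bounded functional (`dual_ext`).

In these terms the vector state at `e 0` is the indicator of `(0, 0)` (`vacuum_Tnm`). Multiplying it
by any `ρ`, on either side, only scales it by `ρ 1`, so it is Haar (`isHaar_vacuum`). Conversely, a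
Haar functional `h` convolved with this state is `c • h`. Comparison at the unit, where `h 1 = 1`,
gives `c = 1`; comparison elsewhere gives `h (T_{n,m}) = 0` (`IsHaar.apply_Tnm`). Hence `h` is the
vector state. Positivity and norm one enter the converse only through `h 1 = 1`, which is
Cauchy–Schwarz for the form `h(A* B)`. -/

/-- A positive functional of norm one on a unital C*-algebra takes the value one at the unit. -/
theorem apply_one_of_positive {S : Type*} [CStarAlgebra S] (h : StrongDual ℂ S)
    (hpos : ∀ A : S, 0 ≤ h (star A * A)) (hnorm : ‖h‖ = 1) : h 1 = 1 := by
  let _ : PartialOrder S := CStarAlgebra.spectralOrder S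
  have _ : StarOrderedRing S := CStarAlgebra.spectralOrderedRing S
  have hnn : ∀ A : S, 0 ≤ A → 0 ≤ h A := fun A hA => by
    obtain ⟨B, rfl⟩ := CStarAlgebra.nonneg_iff_eq_star_mul_self.1 hA
    exact hpos B
  let f : S →ₚ[ℂ] ℂ := PositiveLinearMap.mk₀ h.toLinearMap hnn
  have hf : ∀ A, f A = h A := fun _ => rfl
  have h1 : 0 ≤ h 1 := hnn 1 zero_le_one
  have h1re : h 1 = ((h 1).re : ℂ) := Complex.eq_re_of_ofReal_le h1
  have h1pos : 0 ≤ (h 1).re := (Complex.nonneg_iff.1 h1).1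
  -- Cauchy–Schwarz in the pre-GNS space for the vectors `1` and `A`, combined with `A* A ≤ ‖A‖² 1`:
  -- `|h A|² ≤ h(1) h(A* A) ≤ h(1)² ‖A‖²`. This gives `‖h‖ ≤ h 1`.
  have hcs : ∀ A : S, ‖h A‖ ≤ (h 1).re * ‖A‖ := fun A => by
    have hin : inner ℂ (f.toPreGNS 1) (f.toPreGNS A) = h A := by
      rw [f.preGNS_inner_def]
      simp [hf]
    have hn1 : ‖f.toPreGNS 1‖ ^ 2 = (h 1).re := by
      have := f.preGNS_norm_sq (f.toPreGNS 1)
      simp only [f.ofPreGNS_toPreGNS, star_one, mul_one, hf] at this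
      rw [h1re] at this
      exact_mod_cast this
    have hnA : ‖f.toPreGNS A‖ ^ 2 ≤ (h 1).re * ‖A‖ ^ 2 := by
      have h2 := f.preGNS_norm_sq (f.toPreGNS A)
      simp only [f.ofPreGNS_toPreGNS, hf] at h2
      have h3 : star A * A ≤ algebraMap ℝ S (‖A‖ ^ 2) :=
        CStarAlgebra.star_mul_le_algebraMap_norm_sq
      have h4 := hnn _ (sub_nonneg.2 h3)
      have h5 : h (algebraMap ℝ S (‖A‖ ^ 2)) = ((‖A‖ ^ 2 : ℝ) : ℂ) * h 1 := by
        rw [Algebra.algebraMap_eq_smul_one]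
        have : (‖A‖ ^ 2) • (1 : S) = ((‖A‖ ^ 2 : ℝ) : ℂ) • (1 : S) := (Complex.coe_smul _ _).symm
        rw [this, map_smul, smul_eq_mul]
      rw [map_sub, h5, ← h2, h1re, sub_nonneg] at h4
      have h6 : ‖f.toPreGNS A‖ ^ 2 ≤ ‖A‖ ^ 2 * (h 1).re := by exact_mod_cast h4
      linarith
    rw [← hin]
    refine (norm_inner_le_norm _ _).trans ?_
    refine le_of_sq_le_sq ?_ (by positivity)
    calc _ = ‖f.toPreGNS 1‖ ^ 2 * ‖f.toPreGNS A‖ ^ 2 := by ring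
      _ ≤ (h 1).re * ((h 1).re * ‖A‖ ^ 2) := by rw [hn1]; gcongr
      _ = _ := by ring
  have hge : 1 ≤ (h 1).re := hnorm ▸ h.opNorm_le_bound h1pos hcs
  have hle : (h 1).re ≤ 1 := by
    -- The equality `‖1‖ = 1` needs a nonzero algebra; on the zero algebra `h` would be zero,
    -- against `‖h‖ = 1`.
    have : Nontrivial S := not_subsingleton_iff_nontrivial.1 fun _ => by
      rw [Subsingleton.elim h 0, norm_zero] at hnorm
      exact zero_ne_one hnorm
    have := (Complex.re_le_norm _).trans (h.le_opNorm 1)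
    rwa [hnorm, one_mul, CStarRing.norm_one] at this
  rw [h1re, le_antisymm hle hge, Complex.ofReal_one]

theorem IsState.apply_one {h : StrongDual ℂ Toeplitz} (hh : IsState h) : h 1 = 1 := by
  have hc : IsClosed (Toeplitz : Set (L2 →L[ℂ] L2)) := StarAlgebra.elemental.isClosed ℂ shift
  let _ : CStarAlgebra Toeplitz := StarSubalgebra.cstarAlgebra Toeplitz
  exact apply_one_of_positive h hh.1 hh.2

/-! ### The operators `T_{n,m}` -/

theorem star_shift_mul_shift : star shift * shift = 1 := by
  rw [ContinuousLinearMap.star_eq_adjoint]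
  exact (ContinuousLinearMap.norm_map_iff_adjoint_comp_self shift).1 shiftIsometry.norm_map

/-- In a monoid with `b * a = 1` the elements `a ^ n * b ^ m` are closed under products. -/
theorem exists_pow_mul_pow_eq {M : Type*} [Monoid M] {a b : M} (h : b * a = 1) (n m k l : ℕ) :
    ∃ i j, a ^ n * b ^ m * (a ^ k * b ^ l) = a ^ i * b ^ j := by
  -- The shorter of the inner powers `b ^ m` and `a ^ k` cancels completely; what is left of the
  -- longer one joins the outer power of the same letter.
  rcases le_total m k with hmk | hmk
  · obtain ⟨j, rfl⟩ := Nat.exists_eq_add_of_le hmk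
    refine ⟨n + j, l, ?_⟩
    rw [pow_add a m j, mul_assoc, mul_assoc (a ^ m), ← mul_assoc (b ^ m),
      pow_mul_pow_eq_one m h, one_mul, pow_add, mul_assoc]
  · obtain ⟨j, rfl⟩ := Nat.exists_eq_add_of_le' hmk
    refine ⟨n, j + l, ?_⟩
    rw [pow_add b j k, mul_assoc, mul_assoc (b ^ j), ← mul_assoc (b ^ k),
      pow_mul_pow_eq_one k h, one_mul, pow_add]

/-- The products `T^n T*^m` form a submonoid containing `T = T_{1,0}` and `T* = T_{0,1}`, so the
algebra generated by these two is no larger than the linear span of that submonoid. -/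
theorem adjoin_shift_le_span {u : L2 →L[ℂ] L2} (hu : u ∈ StarAlgebra.adjoin ℂ {shift}) :
    u ∈ Submodule.span ℂ {v | ∃ n m : ℕ, v = shift ^ n * star shift ^ m} := by
  let N : Submonoid (L2 →L[ℂ] L2) :=
    { carrier := {v | ∃ n m : ℕ, v = shift ^ n * star shift ^ m}
      one_mem' := ⟨0, 0, by simp⟩
      mul_mem' := by
        rintro _ _ ⟨n, m, rfl⟩ ⟨k, l, rfl⟩
        exact exists_pow_mul_pow_eq star_shift_mul_shift n m k l }
  have h1 : u ∈ Subalgebra.toSubmodule (Algebra.adjoin ℂ ({shift} ∪ star {shift})) := by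
    rw [← StarAlgebra.adjoin_toSubalgebra]
    exact hu
  rw [Algebra.adjoin_eq_span] at h1
  refine Submodule.span_mono (Submonoid.closure_le (S := N).2 ?_) h1
  rintro v (hv | hv)
  · exact ⟨1, 0, by simpa using hv⟩
  · exact ⟨0, 1, by rw [pow_zero, one_mul, pow_one, ← Set.mem_singleton_iff.1 hv, star_star]⟩

/-- The linear span of the operators `T_{n,m}` is dense in the Toeplitz algebra. -/
theorem dense_span_Tnm :
    Dense (Submodule.span ℂ {A | ∃ n m : ℕ, A = Tnm n m} : Set Toeplitz) := by
  intro A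
  rw [closure_subtype]
  refine closure_mono (fun v hv => ?_) A.2
  replace hv := adjoin_shift_le_span hv
  -- The span is known among operators on `ℓ²`; the induction lifts it to the span inside the
  -- subtype `Toeplitz`.
  induction hv using Submodule.span_induction with
  | mem u hu =>
    obtain ⟨n, m, rfl⟩ := hu
    exact ⟨Tnm n m, Submodule.subset_span ⟨n, m, rfl⟩, rfl⟩
  | zero => exact ⟨0, Submodule.zero_mem _, rfl⟩
  | add u v _ _ hu hv =>
    obtain ⟨s, hs, rfl⟩ := hu
    obtain ⟨t, ht, rfl⟩ := hv
    exact ⟨s + t, Submodule.add_mem _ hs ht, rfl⟩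
  | smul c u _ hu =>
    obtain ⟨s, hs, rfl⟩ := hu
    exact ⟨c • s, Submodule.smul_mem _ c hs, rfl⟩

/-- A bounded functional is determined by its values at the operators `T_{n,m}`. -/
theorem dual_ext {f g : StrongDual ℂ Toeplitz} (h : ∀ n m, f (Tnm n m) = g (Tnm n m)) :
    f = g := by
  refine ContinuousLinearMap.ext_on dense_span_Tnm ?_
  rintro _ ⟨n, m, rfl⟩
  exact h n m

theorem Tnm_zero_zero : Tnm 0 0 = 1 := by simp [Tnm]

theorem tmul_mul_tmul (A B C D : Toeplitz) : tmul A B * tmul C D = tmul (A * C) (B * D) :=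
  Subtype.ext (opTensor_mul _ _ _ _).symm

theorem star_tmul (A B : Toeplitz) : star (tmul A B) = tmul (star A) (star B) :=
  Subtype.ext (opTensor_star _ _)

theorem tmul_pow (A B : Toeplitz) (n : ℕ) : tmul A B ^ n = tmul (A ^ n) (B ^ n) := by
  induction n with
  | zero => simpa using Subtype.ext opTensor_one.symm
  | succ n ih => rw [pow_succ, ih, tmul_mul_tmul, ← pow_succ, ← pow_succ]

theorem comul_Tnm (n m : ℕ) : comul (Tnm n m) = tmul (Tnm n m) (Tnm n m) := by
  rw [Tnm, map_mul, map_pow, map_pow, map_star, comul_T, star_tmul, tmul_pow, tmul_pow,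
    tmul_mul_tmul]

/-- This turns the Haar condition into scalar equations, one for each pair `(n, m)`. -/
theorem conv_Tnm (ρ φ : StrongDual ℂ Toeplitz) (n m : ℕ) :
    conv ρ φ (Tnm n m) = ρ (Tnm n m) * φ (Tnm n m) := by
  change tensorFunctional ρ φ (comul (Tnm n m)) = _
  rw [comul_Tnm, tensorFunctional_tmul]

/-! ### The vacuum state -/

theorem norm_e (n : ℕ) : ‖e n‖ = 1 := by
  rw [← eBasis_apply]
  exact eBasis.orthonormal.1 n

/-- The vector `e 0` is orthogonal to every `shift (e n) = e (n + 1)`, hence to the range of the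
shift. -/
theorem star_shift_e_zero : star shift (e 0) = 0 := by
  refine ext_inner_right ℂ fun x => ?_
  rw [ContinuousLinearMap.star_eq_adjoint, ContinuousLinearMap.adjoint_inner_left, inner_zero_left]
  have : (innerSL ℂ (e 0)).comp shift = 0 := clm_ext_basis eBasis fun n => by
    have h : inner ℂ (eBasis 0) (eBasis (n + 1)) = 0 :=
      eBasis.orthonormal.2 (Nat.succ_ne_zero n).symm
    rw [eBasis_apply, eBasis_apply] at h
    simpa [eBasis_apply, shift_e] using h
  exact congrArg (fun f => f x) this

theorem star_shift_pow_e_zero {m : ℕ} (hm : m ≠ 0) : (star shift ^ m) (e 0) = 0 := by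
  obtain ⟨k, rfl⟩ := Nat.exists_eq_succ_of_ne_zero hm
  rw [pow_succ, mul_apply_eq_comp, star_shift_e_zero, map_zero]

/-- The vector state `A ↦ ⟪e 0, A e 0⟫`. -/
def vacuum : StrongDual ℂ Toeplitz :=
  LinearMap.mkContinuous (coeff Toeplitz (e 0) (e 0)) 1 fun A => by
    change ‖inner ℂ (e 0) ((A : L2 →L[ℂ] L2) (e 0))‖ ≤ _
    refine (norm_inner_le_norm _ _).trans ?_
    have h : ‖(A : L2 →L[ℂ] L2) (e 0)‖ ≤ ‖A‖ * ‖e 0‖ := (A : L2 →L[ℂ] L2).le_opNorm _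
    rw [norm_e, mul_one] at h
    rwa [norm_e, one_mul, one_mul]

theorem vacuum_apply (A : Toeplitz) :
    vacuum A = inner ℂ (e 0) ((A : L2 →L[ℂ] L2) (e 0)) := rfl

theorem vacuum_Tnm (n m : ℕ) : vacuum (Tnm n m) = if n = 0 ∧ m = 0 then 1 else 0 := by
  have h : vacuum (Tnm n m) = inner ℂ ((star shift ^ n) (e 0)) ((star shift ^ m) (e 0)) := by
    -- Moving `T^n` to the left argument makes it `T*^n`, which kills `e 0` as soon as `n ≠ 0`;
    -- likewise `T*^m` on the right.
    change inner ℂ (e 0) ((shift ^ n) ((star shift ^ m) (e 0))) = _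
    rw [← star_pow shift n, ContinuousLinearMap.star_eq_adjoint (shift ^ n),
      ContinuousLinearMap.adjoint_inner_left]
  rw [h]
  rcases eq_or_ne n 0 with rfl | hn
  · rcases eq_or_ne m 0 with rfl | hm
    · simp [inner_self_eq_norm_sq_to_K, norm_e]
    · simp [star_shift_pow_e_zero hm, hm]
  · simp [star_shift_pow_e_zero hn, hn]

theorem isState_vacuum : IsState vacuum := by
  refine ⟨fun A => ?_, le_antisymm (LinearMap.mkContinuous_norm_le _ zero_le_one _) ?_⟩
  · have h : vacuum (star A * A)
        = inner ℂ ((A : L2 →L[ℂ] L2) (e 0)) ((A : L2 →L[ℂ] L2) (e 0)) := by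
      change inner ℂ (e 0) (star (A : L2 →L[ℂ] L2) ((A : L2 →L[ℂ] L2) (e 0))) = _
      rw [ContinuousLinearMap.star_eq_adjoint, ContinuousLinearMap.adjoint_inner_right]
    rw [h, inner_self_eq_norm_sq_to_K]
    have hn : (0 : ℂ) ≤ (‖(A : L2 →L[ℂ] L2) (e 0)‖ : ℂ) := Complex.zero_le_real.2 (norm_nonneg _)
    exact pow_nonneg hn 2
  -- The lower bound for the norm is attained at the unit.
  · have h := vacuum.le_opNorm 1
    have h1 : vacuum 1 = 1 := by simpa [Tnm_zero_zero] using vacuum_Tnm 0 0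
    have hone : ‖(1 : Toeplitz)‖ ≤ 1 := ContinuousLinearMap.norm_id_le
    rw [h1, norm_one] at h
    exact h.trans (mul_le_of_le_one_right (norm_nonneg _) hone)

theorem eq_vacuum_of_Tnm {h : StrongDual ℂ Toeplitz}
    (hT : ∀ n m : ℕ, h (Tnm n m) = if n = 0 ∧ m = 0 then 1 else 0) : h = vacuum :=
  dual_ext fun n m => by rw [hT, vacuum_Tnm]

/-! ### Haar functionals -/

theorem isHaar_vacuum : IsHaar vacuum := by
  refine ⟨isState_vacuum, fun ρ => ⟨ρ 1, dual_ext fun n m => ?_, dual_ext fun n m => ?_⟩⟩ <;>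
  -- The scalar `ρ 1` is forced by the unit `T_{0,0}`; at all other `T_{n,m}` both sides vanish.
  · rw [conv_Tnm, smul_apply, vacuum_Tnm, smul_eq_mul]
    split_ifs with hnm
    · simp [hnm.1, hnm.2, Tnm_zero_zero]
    · simp

/-- The vector state serves as the test functional: it is one at the unit and zero at every other
`T_{n,m}`, so the equation at the unit fixes the scalar and the others annihilate `h`. -/
theorem IsHaar.apply_Tnm {h : StrongDual ℂ Toeplitz} (hh : IsHaar h) (n m : ℕ) :
    h (Tnm n m) = if n = 0 ∧ m = 0 then 1 else 0 := by
  obtain ⟨c, hc, -⟩ := hh.2 vacuum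
  have key : ∀ k l, h (Tnm k l) * vacuum (Tnm k l) = c * h (Tnm k l) := fun k l => by
    rw [← conv_Tnm, hc, smul_apply, smul_eq_mul]
  have h00 : h (Tnm 0 0) = 1 := by rw [Tnm_zero_zero, hh.1.apply_one]
  have hc1 : c = 1 := by simpa [h00, vacuum_Tnm] using (key 0 0).symm
  split_ifs with hnm
  · rw [hnm.1, hnm.2, h00]
  · simpa [vacuum_Tnm, hnm, hc1] using (key n m).symm

end QSemigroup

end

/-- Since `inner ℂ` is conjugate linear in its first argument, `inner ℂ (e 0) (A (e 0))` is `⟨A e₀,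
e₀⟩` in the convention linear in the first argument. -/
theorem theorem8 :
    (∀ h : StrongDual ℂ QSemigroup.Toeplitz, QSemigroup.IsState h →
      (QSemigroup.IsHaar h ↔
        ∀ n m : ℕ, h (QSemigroup.Tnm n m) = if n = 0 ∧ m = 0 then 1 else 0)) ∧
    (∃ h : StrongDual ℂ QSemigroup.Toeplitz, QSemigroup.IsHaar h) ∧
    (∀ h : StrongDual ℂ QSemigroup.Toeplitz, QSemigroup.IsHaar h →
      ∀ A : QSemigroup.Toeplitz,
        h A = inner ℂ (QSemigroup.e 0)
          ((A : QSemigroup.L2 →L[ℂ] QSemigroup.L2) (QSemigroup.e 0))) := by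
  refine ⟨fun h _ => ⟨QSemigroup.IsHaar.apply_Tnm, fun hT => ?_⟩,
    ⟨_, QSemigroup.isHaar_vacuum⟩, fun h hh A => ?_⟩
  · rw [QSemigroup.eq_vacuum_of_Tnm hT]
    exact QSemigroup.isHaar_vacuum
  · rw [QSemigroup.eq_vacuum_of_Tnm hh.apply_Tnm, QSemigroup.vacuum_apply]
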